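/- Let $\pi$ be a recursive set of prime numbers, and let $\overline{\mathbf G}_\pi$ be the pseudovariety of all finite semigroups $S$ such that every subgroup of $S$ (a subsemigroup that is a group under the multiplication of $S$) is a $\pi$-group, i.e. all prime divisors of its order belong to $\pi$. A relational morphism $\varphi\colon T\to S$ of semigroups assigns to each $t\in T$ a nonempty subset $t\varphi\subseteq S$ such that $(t\varphi)(t'\varphi)\subseteq (tt')\varphi$ for all $t,t'\in T$. A subset $Z$ of a finite semigroup $T$ is $\overline{\mathbf G}_\pi$-pointlike if for every relational morphism $\varphi\colon T\to S$ with $S\in\overline{\mathbf G}_\pi$ there is $s\in S$ such that $s\in t\varphi$ for all $t\in Z$. Then the $\overline{\mathbf G}_\pi$-pointlike sets are decidable: there is an algorithm (depending only on $\pi$) that, given the multiplication table of a finite semigroup $T$ with respect to any enumeration of its elements, computes the list of all $\overline{\mathbf G}_\pi$-pointlike subsets of $T$ (each subset given as the increasing list of the indices of its elements). -/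

import Mathlib

/-- A relational morphism `φ : T → S` of semigroups, viewed as a map from `T` to subsets of `S`:
every `t φ` is nonempty, and `(t φ)(t' φ) ⊆ (t t') φ`. -/
structure IsRelationalMorphism {T S : Type*} [Semigroup T] [Semigroup S]
    (φ : T → Set S) : Prop where
  nonempty : ∀ t, (φ t).Nonempty
  mul_mem : ∀ t t' s s', s ∈ φ t → s' ∈ φ t' → s * s' ∈ φ (t * t')

/-- `Z ⊆ T` is `V`-pointlike, for a class `V` of finite semigroups (membership of `S` in the class
is `Finite S` together with `V S`): for every relational morphism `φ : T → S` with `S` in the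
class there is `s : S` with `Z ⊆ s φ⁻¹`. -/
def IsPointlike.{u} (V : ∀ (S : Type u) [Semigroup S], Prop) {T : Type u} [Semigroup T]
    (Z : Set T) : Prop :=
  ∀ (S : Type u) [Semigroup S] [Finite S], V S →
    ∀ φ : T → Set S, IsRelationalMorphism φ → ∃ s : S, Z ⊆ {t | s ∈ φ t}

/-- The subsemigroup `H` of `S` is a subgroup, that is, a group under the multiplication of `S`
(its identity `e` can be any idempotent of `S`). -/
def IsSubgroupOfSemigroup {S : Type*} [Semigroup S] (H : Subsemigroup S) : Prop :=
  ∃ e ∈ H, (∀ x ∈ H, e * x = x ∧ x * e = x) ∧ ∀ x ∈ H, ∃ y ∈ H, x * y = e ∧ y * x = e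

/-- All subgroups of the (finite) semigroup `S` are `π`-groups: every prime that divides the order
of a subgroup belongs to `π`. -/
def SubgroupsArePiGroups (π : Set ℕ) (S : Type*) [Semigroup S] : Prop :=
  ∀ H : Subsemigroup S, IsSubgroupOfSemigroup H → ∀ p : ℕ, p.Prime → p ∣ Nat.card H → p ∈ π

/-- The multiplication table of `T` with respect to an enumeration `e` of its elements by
`0, …, n - 1`: the list of its rows, the entry in row `i` and column `j` being the index of
`e i * e j`. -/
def mulTable {T : Type*} [Semigroup T] {n : ℕ} (e : Fin n ≃ T) : List (List ℕ) :=
  List.ofFn fun i => List.ofFn fun j => (e.symm (e i * e j) : ℕ)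

open Classical in
/-- A subset of `T` written as the increasing list of the indices of its elements. -/
noncomputable def indexList {T : Type*} {n : ℕ} (e : Fin n ≃ T) (Z : Set T) : List ℕ :=
  ((List.finRange n).filter fun i => e i ∈ Z).map Fin.val

universe u

/-! Adjoin an identity to `T`, take `k` larger than the number of subsets of the result, and let `D`
be a product of primes of `π` divisible by every number up to `k` with all prime divisors in `π`.
Close the singletons of `T` under products of sets and under replacing `Z` by the union of `Z ^ (D *
(k + i))`, `i < k`. A subset of `T` is pointlike exactly when it lies in a member of this family
(`isPointlike_iff`). Since `k` rounds of closure suffice and `D` is computable from `π`, the family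
can be computed.

Members are pointlike (`exists_related_of_mem_pointlikeFamily`): if all of `Z` is related to `s`,
then each `Z ^ (D * (k + i))` equals some `Z ^ n` for which `s ^ n` is the idempotent power of `s`,
because the period of `Z` and that of `s` share only a divisor of `D`. So one idempotent is related
to the whole union.

Conversely, the family together with `{1}` is a monoid `M`, ordered by inclusion, in which unions of
the selected powers are joins compatible with multiplication. For such `M`, `hasCover_of_saturated`
builds a finite automaton over `T` with no cycle of prime length outside `π`, whose state after a
word is labelled by an upper bound in `M` of the value of the word. Its transition semigroup has
only `π`-subgroups. Applying pointlikeness to the relational morphism that sends `t` to the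
transitions of words with value `t` puts the pointlike set inside a single label. The automaton
comes from induction on `M` and on the alphabet: if all letters are units, a quotient of the unit
group works; otherwise words are split at a nonunit letter and `M` is replaced by the smaller local
divisor there. -/

/-- The automaton has no cycle of prime length outside `π`: a power of a word of such an exponent
fixes only the states that the word itself fixes. -/
def CycleFree (π : Set ℕ) {A X : Type*} (step : X → A → X) : Prop :=
  ∀ (w : List A) (x : X) (p : ℕ), p.Prime → p ∉ π →
    (fun x => w.foldl step x)^[p] x = x → w.foldl step x = x

/-- A finite automaton without cycles of prime length outside `π`, whose states are labelled by
elements of the ordered monoid `M` in such a way that the label of the state reached by a word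
is an upper bound for the value of the word under `β`. -/
def HasCover (π : Set ℕ) {A M : Type u} [Monoid M] [LE M] (β : A → M) : Prop :=
  ∃ (X : Type u) (_ : Finite X) (x₀ : X) (step : X → A → X) (F : X → M),
    1 ≤ F x₀ ∧ (∀ x a, F x * β a ≤ F (step x a)) ∧ CycleFree π step

/-- `u` is a join of `S` that is preserved by all two-sided multiplications. -/
def IsMulJoin {M : Type*} [Monoid M] [LE M] (S : Set M) (u : M) : Prop :=
  ∀ x y z, x * u * y ≤ z ↔ ∀ s ∈ S, x * s * y ≤ z

/-- Powers with exponents in `J` always have a multiplicative join. -/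
def Saturated (J : Set ℕ) (M : Type*) [Monoid M] [LE M] : Prop :=
  ∀ z : M, ∃ u, IsMulJoin ((fun j => z ^ j) '' J) u

/-! ### Multiplicative joins -/

namespace IsMulJoin

variable {M : Type*} [Monoid M]

/-- The context `x, y` in the definition absorbs the other factor, so the two joins can be unfolded
one after the other. -/
theorem mul [LE M] {S S' : Set M} {u u' : M} (h : IsMulJoin S u) (h' : IsMulJoin S' u') :
    IsMulJoin (Set.image2 (· * ·) S S') (u * u') := by
  intro x y z
  rw [show x * (u * u') * y = x * u * (u' * y) by simp only [mul_assoc], h]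
  constructor
  · rintro H _ ⟨s, hs, s', hs', rfl⟩
    have := H s hs
    rw [← mul_assoc, h'] at this
    simpa only [mul_assoc] using this s' hs'
  · intro H s hs
    rw [← mul_assoc, h']
    intro s' hs'
    have := H _ ⟨s, hs, s', hs', rfl⟩
    simpa only [mul_assoc] using this

theorem singleton [LE M] (u : M) : IsMulJoin {u} u := by
  intro x y z; simp

theorem le_of_subset [Preorder M] {S S' : Set M} {u u' : M} (h : IsMulJoin S u)
    (h' : IsMulJoin S' u') (hS : S ⊆ S') : u ≤ u' := by
  have := (h 1 1 u').2 (fun s hs => (h' 1 1 u').1 (by simp) s (hS hs))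
  simpa using this

end IsMulJoin

/-! ### Local divisors -/

/-- The local divisor of `M` at `c`: the set `c M ∩ M c` with the product `x c ∘ c y = x c y`. -/
def LocalDivisor {M : Type u} [Monoid M] (c : M) : Type u :=
  {p : M // (∃ x, p = x * c) ∧ ∃ y, p = c * y}

namespace LocalDivisor

variable {M : Type u} [Monoid M] {c : M}

noncomputable instance : Mul (LocalDivisor c) where
  mul p q := ⟨p.2.1.choose * q.1, by
    obtain ⟨x, hx⟩ := q.2.1
    obtain ⟨y, hy⟩ := q.2.2
    obtain ⟨y', hy'⟩ := p.2.2
    refine ⟨⟨p.2.1.choose * x, by rw [hx, mul_assoc]⟩, ⟨y' * y, ?_⟩⟩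
    rw [hy, ← mul_assoc, ← p.2.1.choose_spec, ← mul_assoc, ← hy']⟩

/-- If `p = x * c` and `q = c * y`, then `x * q = x * c * y = p * y`; hence the chosen `x` is
irrelevant and the product can be computed from either side. -/
theorem mul_val_right {p q : LocalDivisor c} {y : M} (h : q.1 = c * y) :
    (p * q).1 = p.1 * y := by
  change p.2.1.choose * q.1 = _
  rw [h, ← mul_assoc, ← p.2.1.choose_spec]

theorem mul_val_left {p q : LocalDivisor c} {x : M} (h : p.1 = x * c) :
    (p * q).1 = x * q.1 := by
  obtain ⟨y, hy⟩ := q.2.2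
  rw [mul_val_right hy, h, hy, mul_assoc]

instance : One (LocalDivisor c) where
  one := ⟨c, ⟨1, (one_mul c).symm⟩, ⟨1, (mul_one c).symm⟩⟩

theorem one_val : (1 : LocalDivisor c).1 = c := rfl

noncomputable instance : Monoid (LocalDivisor c) where
  mul_assoc p q r := by
    obtain ⟨x, hx⟩ := p.2.1
    obtain ⟨y, hy⟩ := r.2.2
    apply Subtype.ext
    rw [mul_val_right hy, mul_val_left hx, mul_val_left hx, mul_val_right hy, mul_assoc]
  one_mul p := by
    apply Subtype.ext
    rw [mul_val_left (x := 1) (by rw [one_val, one_mul]), one_mul]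
  mul_one p := by
    apply Subtype.ext
    rw [mul_val_right (y := 1) (by rw [one_val, mul_one]), mul_one]

theorem pow_val_left {p : LocalDivisor c} {x : M} (h : p.1 = x * c) (n : ℕ) :
    (p ^ n).1 = x ^ n * c := by
  induction n with
  | zero => simp [one_val]
  | succ n ih => rw [pow_succ', mul_val_left h, ih, pow_succ', mul_assoc]

theorem pow_val_right {p : LocalDivisor c} {y : M} (h : p.1 = c * y) (n : ℕ) :
    (p ^ n).1 = c * y ^ n := by
  induction n with
  | zero => simp [one_val]
  | succ n ih => rw [pow_succ, mul_val_right h, ih, pow_succ, mul_assoc]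

instance [PartialOrder M] : PartialOrder (LocalDivisor c) :=
  inferInstanceAs (PartialOrder {p : M // (∃ x, p = x * c) ∧ ∃ y, p = c * y})

theorem le_iff [PartialOrder M] {p q : LocalDivisor c} : p ≤ q ↔ p.1 ≤ q.1 := Iff.rfl

instance [PartialOrder M] [MulLeftMono M] : MulLeftMono (LocalDivisor c) where
  elim p q r h := by
    obtain ⟨x, hx⟩ := p.2.1
    rw [le_iff, mul_val_left hx, mul_val_left hx]
    exact mul_le_mul_right (le_iff.1 h) x

instance [Finite M] : Finite (LocalDivisor c) :=
  inferInstanceAs (Finite {p : M // (∃ x, p = x * c) ∧ ∃ y, p = c * y})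

/-- The element `1` is missing: `1 = x * c = c * y` would make `c` a unit. -/
theorem card_lt [Finite M] (hc : ¬ IsUnit c) : Nat.card (LocalDivisor c) < Nat.card M := by
  refine Finite.card_subtype_lt (x := (1 : M)) ?_
  rintro ⟨⟨x, hx⟩, ⟨y, hy⟩⟩
  exact hc ⟨⟨c, x, by rw [← left_inv_eq_right_inv hx.symm hy.symm] at hy; exact hy.symm,
    hx.symm⟩, rfl⟩

/-- For `p = x * c = c * y` the powers in the local divisor are `x ^ j * c = c * y ^ j`. With `u`,
`v` the joins of the powers of `x` and `y`, both `u * c` and `c * v` are joins of this one set, so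
they agree. This places the join in the local divisor. -/
theorem saturated [PartialOrder M] {J : Set ℕ} (h : Saturated J M) :
    Saturated J (LocalDivisor c) := by
  intro p
  obtain ⟨x, hx⟩ := p.2.1
  obtain ⟨y, hy⟩ := p.2.2
  obtain ⟨u, hu⟩ := h x
  obtain ⟨v, hv⟩ := h y
  have huc := hu.mul (IsMulJoin.singleton c)
  have hcv := (IsMulJoin.singleton c).mul hv
  have hS : Set.image2 (· * ·) ((fun j => x ^ j) '' J) {c} =
      Set.image2 (· * ·) {c} ((fun j => y ^ j) '' J) := by
    simp only [Set.image2_singleton_left, Set.image2_singleton_right, Set.image_image]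
    refine Set.image_congr fun j _ => ?_
    rw [← pow_val_left hx, ← pow_val_right hy]
  have he : u * c = c * v :=
    le_antisymm (huc.le_of_subset hcv hS.le) (hcv.le_of_subset huc hS.ge)
  obtain ⟨w, hw⟩ : ∃ w : LocalDivisor c, w.1 = u * c := ⟨⟨u * c, ⟨u, rfl⟩, ⟨v, he⟩⟩, rfl⟩
  refine ⟨w, ?_⟩
  intro q r s
  obtain ⟨a, ha⟩ := q.2.1
  obtain ⟨b, hb⟩ := r.2.2
  have key : ∀ t : LocalDivisor c, (q * t * r).1 = a * t.1 * b := fun t => by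
    rw [mul_val_right hb, mul_val_left ha]
  rw [le_iff, key, hw]
  refine (huc a b s.1).trans ?_
  simp only [Set.image2_singleton_right, Set.image_image, Set.forall_mem_image, le_iff, key,
    pow_val_left hx]

end LocalDivisor

/-! ### The case of units -/

section Units

variable {M : Type u} [Monoid M] [PartialOrder M]

/-- Among the subsets of the subgroup that contain `1` and have a multiplicative join, take a
maximal one. Multiplying it by a cyclic group generated by some `g ^ D` again gives such a set, so
it is closed under right multiplication by all the generators and is the whole subgroup. -/
theorem exists_isMulJoin_closure_pow [Finite M] {D k : ℕ} (hk : Nat.card M ≤ k)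
    (hM : Saturated ((fun i => D * (k + i)) '' Set.Iio k) M) :
    ∃ u : M, IsMulJoin ((fun g : Mˣ => (g : M)) ''
      (Subgroup.closure (Set.range fun g : Mˣ => g ^ D) : Set Mˣ)) u := by
  classical
  set N := Subgroup.closure (Set.range fun g : Mˣ => g ^ D) with hN
  let 𝒮 : Set (Set Mˣ) := {S | 1 ∈ S ∧ S ⊆ N ∧ ∃ u : M, IsMulJoin ((fun g : Mˣ => (g : M)) '' S) u}
  have hfin : 𝒮.Finite := Set.toFinite _
  have hne : 𝒮.Nonempty := ⟨{1}, rfl, by simp, 1, by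
    simpa using IsMulJoin.singleton (1 : M)⟩
  obtain ⟨S, hS⟩ := hfin.exists_maximal hne
  obtain ⟨h1, hSN, u, hu⟩ := hS.prop
  have hmul : ∀ g : Mˣ, ∀ s ∈ S, s * g ^ D ∈ S := by
    intro g s hs
    obtain ⟨v, hv⟩ := hM (g : M)
    let W : Set Mˣ := (fun i => (g ^ D) ^ (k + i)) '' Set.Iio k
    have ho : 0 < orderOf (g ^ D) := orderOf_pos _
    have hok : orderOf (g ^ D) ≤ k := by
      refine le_trans ?_ hk
      refine (orderOf_le_card (G := Mˣ)).trans ?_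
      exact Nat.card_le_card_of_injective _ Units.val_injective
    -- The order of `g ^ D` is at most `k`, so `k` consecutive exponents reach every residue;
    -- `(orderOf (g ^ D) - 1) * k` plays the role of `-k` modulo the order.
    have hW : ∀ r : ℕ, (g ^ D) ^ r ∈ W := by
      intro r
      refine ⟨(r + (orderOf (g ^ D) - 1) * k) % orderOf (g ^ D),
        (Nat.mod_lt _ ho).trans_le hok, ?_⟩
      change (g ^ D) ^ _ = _
      rw [pow_eq_pow_iff_modEq]
      have : k + (r + (orderOf (g ^ D) - 1) * k) = r + orderOf (g ^ D) * k := by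
        obtain ⟨o, ho'⟩ := Nat.exists_eq_succ_of_ne_zero ho.ne'
        rw [ho']; simp; ring
      calc k + (r + (orderOf (g ^ D) - 1) * k) % orderOf (g ^ D)
          ≡ k + (r + (orderOf (g ^ D) - 1) * k) [MOD orderOf (g ^ D)] :=
            (Nat.mod_modEq _ _).add_left k
        _ = r + orderOf (g ^ D) * k := this
        _ ≡ r [MOD orderOf (g ^ D)] := by simp [Nat.ModEq]
    have hWN : W ⊆ N := by
      rintro _ ⟨i, -, rfl⟩
      exact N.pow_mem (Subgroup.subset_closure ⟨g, rfl⟩) _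
    have hmem : Set.image2 (· * ·) S W ∈ 𝒮 := by
      refine ⟨⟨1, h1, 1, by simpa using hW 0, by simp⟩, ?_, u * v, ?_⟩
      · rintro _ ⟨a, ha, b, hb, rfl⟩
        exact N.mul_mem (hSN ha) (hWN hb)
      · convert hu.mul hv using 1
        rw [Set.image_image2, Set.image2_image_left]
        simp only [W, Set.image_image, Set.image2_image_right, Units.val_mul,
          Units.val_pow_eq_pow_val, pow_mul]
    refine hS.le_of_ge hmem ?_ ⟨s, hs, _, hW 1, by simp⟩
    intro a ha
    exact ⟨a, ha, 1, by simpa using hW 0, by simp⟩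
  have hNS : (N : Set Mˣ) ⊆ S := by
    have : ∀ g ∈ N, ∀ s ∈ S, s * g ∈ S := by
      intro g hg
      rw [hN] at hg
      have hg' : g ∈ Submonoid.closure (Set.range fun g : Mˣ => g ^ D) := by
        rw [← Subgroup.closure_toSubmonoid_of_finite]
        exact hg
      induction hg' using Submonoid.closure_induction with
      | mem x hx => obtain ⟨g, rfl⟩ := hx; exact hmul g
      | one => simp
      | mul x y hx hy ihx ihy =>
        intro s hs
        rw [← mul_assoc]
        have hsub : ∀ x, x ∈ Submonoid.closure (Set.range fun g : Mˣ => g ^ D) →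
            x ∈ Subgroup.closure (Set.range fun g : Mˣ => g ^ D) := fun x hx => by
          rw [← Subgroup.closure_toSubmonoid_of_finite] at hx
          exact hx
        exact ihy (hsub _ hy) _ (ihx (hsub _ hx) _ hs)
    intro g hg
    simpa using this g hg 1 h1
  exact ⟨u, hSN.antisymm hNS ▸ hu⟩

/-- The automaton is the quotient of the unit group by the subgroup generated by `D`-th powers. Its
exponent divides `D`, which is coprime to the primes outside `π`, so no cycle of such a length
occurs. -/
theorem hasCover_of_isUnit [Finite M] {π : Set ℕ} {D k : ℕ} (hk : Nat.card M ≤ k)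
    (hD : ∀ p : ℕ, p.Prime → p ∉ π → p.Coprime D)
    (hM : Saturated ((fun i => D * (k + i)) '' Set.Iio k) M) {A : Type u} (β : A → M)
    (hβ : ∀ a, IsUnit (β a)) : HasCover π β := by
  choose b hb using hβ
  set N := Subgroup.closure (Set.range fun g : Mˣ => g ^ D) with hN
  obtain ⟨u, hu⟩ := exists_isMulJoin_closure_pow hk hM
  have hnormal : N.Normal := by
    refine ⟨fun n hn g => ?_⟩
    induction hn using Subgroup.closure_induction with
    | mem x hx =>
      obtain ⟨y, rfl⟩ := hx
      exact Subgroup.subset_closure ⟨g * y * g⁻¹, by simp [conj_pow]⟩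
    | one => simp
    | mul x y _ _ hx hy => simpa [mul_assoc] using N.mul_mem hx hy
    | inv x _ hx => simpa [mul_assoc] using N.inv_mem hx
  have hpow : ∀ g : Mˣ ⧸ N, g ^ D = 1 := by
    intro g
    induction g using QuotientGroup.induction_on with
    | H g => rw [← QuotientGroup.mk_pow, QuotientGroup.eq_one_iff]
             exact Subgroup.subset_closure ⟨g, rfl⟩
  -- The label `x.out * u` is the multiplicative join of the elements of the coset `x`.
  refine ⟨Mˣ ⧸ N, inferInstance, 1, fun x a => x * (b a : Mˣ ⧸ N), fun x => x.out * u,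
    ?_, ?_, ?_⟩
  · have h := (hu ((1 : Mˣ ⧸ N).out : M) 1 (((1 : Mˣ ⧸ N).out : M) * u)).1 (by simp)
      ((((1 : Mˣ ⧸ N).out)⁻¹ : Mˣ) : M) ⟨_, N.inv_mem
        ((QuotientGroup.eq_one_iff _).1 (QuotientGroup.out_eq' _)), rfl⟩
    simpa using h
  · intro x a
    rw [← hb a]
    refine (hu _ _ _).2 ?_
    rintro _ ⟨g, hg, rfl⟩
    set y : Mˣ ⧸ N := x * (b a : Mˣ ⧸ N) with hy
    have hmem : y.out⁻¹ * (x.out * g * b a) ∈ N := by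
      rw [← QuotientGroup.eq_one_iff]
      have hg' : (g : Mˣ ⧸ N) = 1 := (QuotientGroup.eq_one_iff g).2 hg
      simp [hg', hy]
    have h := (hu (y.out : M) 1 ((y.out : M) * u)).1 (by simp) _ ⟨_, hmem, rfl⟩
    simpa [mul_assoc] using h
  · intro w x p hp hpπ h
    have hact : ∀ (w : List A) (x : Mˣ ⧸ N), w.foldl (fun x a => x * (b a : Mˣ ⧸ N)) x =
        x * (w.map fun a => (b a : Mˣ ⧸ N)).prod := by
      intro w
      induction w with
      | nil => simp
      | cons a w ih => intro x; simp [ih, mul_assoc]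
    simp only [hact] at h ⊢
    set g := (w.map fun a => (b a : Mˣ ⧸ N)).prod
    rw [mul_right_iterate] at h
    have hgp : g ^ p = 1 := by simpa using h
    have : g = 1 := by
      rw [← orderOf_eq_one_iff]
      exact Nat.eq_one_of_dvd_coprimes (hD p hp hpπ) (orderOf_dvd_of_pow_eq_one hgp)
        (orderOf_dvd_of_pow_eq_one (hpow g))
    rw [this, mul_one]

end Units

/-! ### Splitting words at a nonunit letter -/

section Combine

variable {A M X Y : Type u} (a : A) 

open Classical in
/-- Words are split at the letter `a`: the first component stores the state reached by the factor
before the first `a` and the state of the second automaton on the factors between two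
occurrences of `a`; the second component is the state of the first automaton since the last `a`. -/
noncomputable def splitStep (x₀ : X) (stepX : X → {b // b ≠ a} → X) (y₀ : Y) (stepY : Y → X → Y) :
    Option (X × Y) × X → A → Option (X × Y) × X := fun s b =>
  if h : b = a then
    (match s.1 with
      | none => some (s.2, y₀)
      | some (x', y) => some (x', stepY y s.2), x₀)
  else (s.1, stepX s.2 ⟨b, h⟩)

variable {a} {x₀ : X} {stepX : X → {b // b ≠ a} → X} {y₀ : Y} {stepY : Y → X → Y}

theorem iterate_splitStep_some (w : List A) (x : X) : ∃ (v : List X) (x₁ : X), ∀ x' y,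
    w.foldl (splitStep a x₀ stepX y₀ stepY) (some (x', y), x) =
      (some (x', v.foldl stepY y), x₁) := by
  induction w generalizing x with
  | nil => exact ⟨[], x, fun _ _ => rfl⟩
  | cons b w ih =>
    by_cases h : b = a
    · obtain ⟨v, x₁, hv⟩ := ih x₀
      exact ⟨x :: v, x₁, fun x' y => by simp [splitStep, h, ← hv]⟩
    · obtain ⟨v, x₁, hv⟩ := ih (stepX x ⟨b, h⟩)
      exact ⟨v, x₁, fun x' y => by simp [splitStep, h, ← hv]⟩

theorem foldl_splitStep_of_notMem (w : List A) (hw : a ∉ w) : ∃ v : List {b // b ≠ a},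
    ∀ s, w.foldl (splitStep a x₀ stepX y₀ stepY) s = (s.1, v.foldl stepX s.2) := by
  induction w with
  | nil => exact ⟨[], fun _ => rfl⟩
  | cons b w ih =>
    obtain ⟨v, hv⟩ := ih (fun h => hw (List.mem_cons_of_mem _ h))
    have hb : b ≠ a := fun h => hw (h ▸ List.mem_cons_self)
    exact ⟨⟨b, hb⟩ :: v, fun s => by simp [splitStep, hb, hv]⟩

/-- A word without `a` moves only the current state of the first automaton. If the word contains
`a`, rotate it to end in `a`: after `a` the current state is reset to `x₀` and the prefix state is
frozen, so the rotated word acts only on the second automaton, where cycle-freeness applies.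
Rotating back, the image of the state is fixed, hence so is the state. -/
theorem cycleFree_splitStep {π : Set ℕ} (hX : CycleFree π stepX) (hY : CycleFree π stepY) :
    CycleFree π (splitStep a x₀ stepX y₀ stepY) := by
  intro w s p hp hpπ h
  by_cases hw : a ∈ w
  · obtain ⟨w₁, w₂, rfl⟩ := List.append_of_mem hw
    set step := splitStep a x₀ stepX y₀ stepY with hstep
    set f := fun s => (w₁ ++ a :: w₂).foldl step s with hf
    set g := fun s => w₂.foldl step s with hg
    set r := fun s => (w₁ ++ [a]).foldl step s with hr
    have hfgr : f = g ∘ r := by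
      funext s; simp [hf, hg, hr]
    obtain ⟨v, x₁, hv⟩ := iterate_splitStep_some (a := a) (x₀ := x₀) (stepX := stepX) (y₀ := y₀)
      (stepY := stepY) (w₂ ++ w₁ ++ [a]) x₀
    -- The rotated word ends in `a`, which resets the current state.
    have hx₁ : x₁ = x₀ := by
      by_cases hXY : Nonempty (X × Y)
      · obtain ⟨x', y⟩ := hXY
        have := congrArg Prod.snd (hv x' y)
        rw [List.foldl_append] at this
        simpa [splitStep] using this.symm
      · exact absurd ⟨x₀, y₀⟩ hXY
    subst hx₁
    have hrg : ∀ x' y, (r ∘ g) (some (x', y), x₁) = (some (x', v.foldl stepY y), x₁) := by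
      intro x' y
      rw [← hv]; simp [hr, hg, hstep]
    obtain ⟨⟨x', y⟩, hrs⟩ : ∃ q : X × Y, r s = (some q, x₁) := by
      have : r s = step (w₁.foldl step s) a := by simp [hr]
      rw [this]
      simp only [hstep, splitStep, dif_pos]
      split <;> exact ⟨_, rfl⟩
    have hit : (r ∘ g)^[p] (r s) = r s := by
      have hsc : Function.Semiconj r f (r ∘ g) := fun s => by rw [hfgr]; rfl
      rw [← (hsc.iterate_right p).eq, h]
    have hit' : ∀ n y, (r ∘ g)^[n] (some (x', y), x₁) =
        (some (x', (fun y => v.foldl stepY y)^[n] y), x₁) := by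
      intro n
      induction n with
      | zero => simp
      | succ n ih => intro y; rw [Function.iterate_succ_apply, hrg, ih]; rfl
    have hfix : (r ∘ g) (r s) = r s := by
      rw [hrs, hit'] at hit
      rw [hrs, hrg, hY v y p hp hpπ (by simpa using hit)]
    have hff : f (f s) = f s := by
      rw [hfgr]
      exact congrArg g hfix
    have : f^[p] s = f s := by
      obtain ⟨n, rfl⟩ := Nat.exists_eq_succ_of_ne_zero hp.ne_zero
      rw [Function.iterate_succ_apply, Function.iterate_fixed hff]
    exact this.symm.trans h
  · obtain ⟨v, hv⟩ := foldl_splitStep_of_notMem (x₀ := x₀) (stepX := stepX) (y₀ := y₀)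
      (stepY := stepY) w hw
    simp only [hv] at h ⊢
    have hit : ∀ n (s : Option (X × Y) × X), (fun s => (s.1, v.foldl stepX s.2))^[n] s =
        (s.1, (fun x => v.foldl stepX x)^[n] s.2) := by
      intro n
      induction n with
      | zero => simp
      | succ n ih => intro s; rw [Function.iterate_succ_apply, ih]; rfl
    rw [hit] at h
    exact Prod.ext rfl (hX v s.2 p hp hpπ (congrArg Prod.snd h))

end Combine

theorem hasCover_of_localDivisor {π : Set ℕ} {A M : Type u} [Monoid M] [PartialOrder M]
    [MulLeftMono M] {β : A → M} (a : A)
    (h₀ : HasCover π fun b : {b // b ≠ a} => β b)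
    (h₁ : ∀ (B : Type u) [Finite B] (γ : B → LocalDivisor (β a)), HasCover π γ) :
    HasCover π β := by
  obtain ⟨X, _, x₀, stepX, F, hF₀, hF, hX⟩ := h₀
  -- A factor between two occurrences of `a` becomes one letter, namely the state it reaches. Its
  -- value includes both neighbouring `β a`, and the product of the local divisor merges the copies
  -- shared by adjacent letters.
  obtain ⟨γ, hγ⟩ : ∃ γ : X → LocalDivisor (β a), ∀ x, (γ x).1 = β a * (F x * β a) :=
    ⟨fun x => ⟨β a * (F x * β a), ⟨β a * F x, (mul_assoc _ _ _).symm⟩, ⟨_, rfl⟩⟩, fun _ => rfl⟩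
  obtain ⟨Y, _, y₀, stepY, G, hG₀, hG, hY⟩ := h₁ X γ
  -- The label multiplies bounds for the prefix before the first `a`, for the part from the first to
  -- the last `a`, and for the suffix after it.
  refine ⟨Option (X × Y) × X, inferInstance, (none, x₀), splitStep a x₀ stepX y₀ stepY,
    fun s => match s.1 with
      | none => F s.2
      | some (x', y) => F x' * (G y).1 * F s.2, hF₀, ?_, cycleFree_splitStep hX hY⟩
  -- Resetting the current state to `x₀` after `a` is harmless since `1 ≤ F x₀`.
  have hle : ∀ m : M, m ≤ m * F x₀ := fun m => by simpa using mul_le_mul_right hF₀ m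
  rintro ⟨_ | ⟨x', y⟩, x⟩ b
  · by_cases h : b = a
    · subst h
      simp only [splitStep, dif_pos]
      exact (mul_le_mul_right (LocalDivisor.le_iff.1 hG₀) _).trans (hle _)
    · simpa [splitStep, h] using hF x ⟨b, h⟩
  · by_cases h : b = a
    · subst h
      simp only [splitStep, dif_pos]
      refine le_trans ?_ (hle _)
      have := LocalDivisor.le_iff.1 (hG y x)
      rw [LocalDivisor.mul_val_right (hγ x)] at this
      simpa only [mul_assoc] using mul_le_mul_right this (F x')
    · simp only [splitStep, h, dif_neg, not_false_eq_true, mul_assoc]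
      rw [← mul_assoc, ← mul_assoc (F x')]
      exact mul_le_mul_right (hF x ⟨b, h⟩) _

/-- Outer induction on the size of `M`, inner induction on the alphabet. Removing a nonunit letter
shrinks the alphabet; passing to its local divisor shrinks `M` while the alphabet may grow. The
exponents stay fixed, because `k` need only bound the size of the monoid. -/
theorem hasCover_of_saturated {π : Set ℕ} {D k : ℕ} (hD : ∀ p : ℕ, p.Prime → p ∉ π → p.Coprime D)
    (M : Type u) [Monoid M] [PartialOrder M] [MulLeftMono M] [Finite M] (hk : Nat.card M ≤ k)
    (hM : Saturated ((fun i => D * (k + i)) '' Set.Iio k) M) (A : Type u) [Finite A] (β : A → M) :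
    HasCover π β := by
  induction hm : Nat.card M using Nat.strong_induction_on generalizing M A with
  | _ m ihM =>
  induction hn : Nat.card A using Nat.strong_induction_on generalizing A with
  | _ n ihA =>
  by_cases h : ∀ a, IsUnit (β a)
  · exact hasCover_of_isUnit hk hD hM β h
  · push Not at h
    obtain ⟨a, ha⟩ := h
    have hlt := LocalDivisor.card_lt ha
    refine hasCover_of_localDivisor a (ihA _ ?_ _ _ rfl) fun B _ γ =>
      ihM _ (hm ▸ hlt) _ (hlt.le.trans hk) (LocalDivisor.saturated hM) _ _ rfl
    rw [← hn]
    exact Finite.card_subtype_lt (x := a) (by simp)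

open scoped Pointwise

/-! ### Subgroups and periods of powers -/

section Subgroups

theorem IsSubgroupOfSemigroup.exists_mulEquiv {S : Type u} [Semigroup S] {H : Subsemigroup S}
    (h : IsSubgroupOfSemigroup H) : ∃ (G : Type u) (_ : Group G), Nonempty (H ≃* G) := by
  obtain ⟨e, he, h₁, h₂⟩ := h
  choose! inv hinv using h₂
  let G : Group H :=
    { (inferInstance : Semigroup H) with
      one := ⟨e, he⟩
      one_mul := fun x => Subtype.ext (h₁ x x.2).1
      mul_one := fun x => Subtype.ext (h₁ x x.2).2
      inv := fun x => ⟨inv x, (hinv x x.2).1⟩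
      inv_mul_cancel := fun x => Subtype.ext (hinv x x.2).2.2 }
  exact ⟨H, G, ⟨{ Equiv.refl H with map_mul' := fun _ _ => rfl }⟩⟩

theorem exists_map_eq_pow {S P G : Type*} [Semigroup S] [Monoid P] [Group G] {H : Subsemigroup S}
    (ι : S →ₙ* P) (f : H ≃* G) (x : H) {n : ℕ} (hn : n ≠ 0) :
    ∃ y : H, ι y = ι x ^ n ∧ f y = f x ^ n := by
  obtain ⟨n, rfl⟩ := Nat.exists_eq_succ_of_ne_zero hn
  clear hn
  induction n with
  | zero => exact ⟨x, by simp⟩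
  | succ n ih =>
    obtain ⟨y, hy, hy'⟩ := ih
    exact ⟨y * x, by rw [pow_succ, ← hy]; simp, by rw [pow_succ, ← hy', map_mul]⟩

end Subgroups

section Periods

instance {S : Type*} [Finite S] : Finite (WithOne S) := inferInstanceAs (Finite (Option S))

theorem pow_add_mul_of_period {P : Type*} [Monoid P] {z : P} {i m : ℕ} (h : z ^ (i + m) = z ^ i)
    {j : ℕ} (hj : i ≤ j) (q : ℕ) : z ^ (j + m * q) = z ^ j := by
  induction q with
  | zero => simp
  | succ q ih =>
    obtain ⟨l, rfl⟩ := Nat.exists_eq_add_of_le hj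
    rw [← ih, show i + l + m * (q + 1) = i + m + (l + m * q) by ring, pow_add, h, ← pow_add,
      add_assoc]

theorem exists_period {P : Type*} [Monoid P] [Finite P] {k : ℕ} (hk : Nat.card P < k) (z : P) :
    ∃ i m, i ≤ k ∧ m ≠ 0 ∧ m ≤ k ∧ z ^ (i + m) = z ^ i := by
  have : ¬ Function.Injective fun i : Fin k => z ^ (i : ℕ) := fun h => by
    have := Nat.card_le_card_of_injective _ h
    simp at this
    omega
  simp only [Function.Injective, not_forall] at this
  obtain ⟨a, b, hab, hne⟩ := this
  have hne' : (a : ℕ) ≠ b := fun h => hne (Fin.ext h)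
  rcases lt_or_gt_of_ne hne' with h | h
  · exact ⟨a, b - a, by omega, by omega, by omega, by rw [Nat.add_sub_cancel' h.le]; exact hab.symm⟩
  · exact ⟨b, a - b, by omega, by omega, by omega, by rw [Nat.add_sub_cancel' h.le]; exact hab⟩

theorem exists_pow_isIdempotentElem {P : Type*} [Monoid P] [Finite P] (z : P) :
    ∃ a, a ≠ 0 ∧ IsIdempotentElem (z ^ a) := by
  obtain ⟨i, m, -, hm, -, h⟩ := exists_period (Nat.lt_succ_self _) z
  -- A nonzero multiple of the period lying beyond the preperiod.
  refine ⟨m * (i + 1), by simp [hm], ?_⟩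
  rw [IsIdempotentElem, ← pow_add]
  exact pow_add_mul_of_period h
    ((Nat.le_succ i).trans (Nat.le_mul_of_pos_left _ (Nat.pos_of_ne_zero hm))) _

theorem WithOne.exists_coe_eq_pow {S : Type*} [Semigroup S] (s : S) {n : ℕ} (hn : n ≠ 0) :
    ∃ x : S, (x : WithOne S) = (s : WithOne S) ^ n := by
  obtain ⟨n, rfl⟩ := Nat.exists_eq_succ_of_ne_zero hn
  clear hn
  induction n with
  | zero => exact ⟨s, by simp⟩
  | succ n ih =>
    obtain ⟨y, hy⟩ := ih
    exact ⟨y * s, by rw [pow_succ, ← hy, WithOne.coe_mul]⟩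

/-- If `s ^ a` is idempotent, the powers `s ^ n` with `n ≥ a` form a subgroup with identity `s ^ a`.
Its order serves as `d`, by Lagrange's theorem applied to `s ^ (a + 1)`. -/
theorem SubgroupsArePiGroups.exists_period {π : Set ℕ} {S : Type u} [Semigroup S] [Finite S]
    (h : SubgroupsArePiGroups π S) (s : S) :
    ∃ (d a : ℕ) (e : S), d ≠ 0 ∧ (∀ p : ℕ, p.Prime → p ∣ d → p ∈ π) ∧
      ∀ n, a ≤ n → d ∣ n → (s : WithOne S) ^ n = e := by
  obtain ⟨a, ha, hidem⟩ := exists_pow_isIdempotentElem (s : WithOne S)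
  set z : WithOne S := (s : WithOne S) with hz
  have hza : ∀ n, a ≤ n → z ^ (a + n) = z ^ n := by
    intro n hn
    obtain ⟨l, rfl⟩ := Nat.exists_eq_add_of_le hn
    rw [pow_add z a l, pow_add z a, pow_add z a, ← mul_assoc, hidem.eq]
  obtain ⟨e, he⟩ := WithOne.exists_coe_eq_pow s ha
  let H : Subsemigroup S :=
    { carrier := {x | ∃ n, a ≤ n ∧ (x : WithOne S) = z ^ n}
      mul_mem' := by
        rintro x y ⟨n, hn, hx⟩ ⟨m, hm, hy⟩
        exact ⟨n + m, by omega, by rw [WithOne.coe_mul, hx, hy, pow_add]⟩ }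
  have heH : e ∈ H := ⟨a, le_rfl, he⟩
  have hH : IsSubgroupOfSemigroup H := by
    refine ⟨e, heH, ?_, ?_⟩
    · rintro x ⟨n, hn, hx⟩
      constructor <;> apply WithOne.coe_injective
      · rw [WithOne.coe_mul, hx, he, ← pow_add, hza n hn]
      · rw [WithOne.coe_mul, hx, he, ← pow_add, add_comm, hza n hn]
    · rintro x ⟨n, hn, hx⟩
      have hn0 : n ≠ 0 := by omega
      obtain ⟨a', rfl⟩ := Nat.exists_eq_succ_of_ne_zero ha
      -- The inverse of `s ^ n` is `s ^ (n * (2 * a - 1))`, the exponents adding up to a multiple of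
      -- `a`. The simpler `n * (a - 1)` would vanish for `a = 1`.
      have hm0 : n * (2 * a' + 1) ≠ 0 := by simp [hn0]
      obtain ⟨y, hy⟩ := WithOne.exists_coe_eq_pow s hm0
      have hpow : z ^ (n + n * (2 * a' + 1)) = z ^ (a' + 1) := by
        rw [show n + n * (2 * a' + 1) = (a' + 1) * (n * 2) by ring, pow_mul]
        obtain ⟨l, hl⟩ := Nat.exists_eq_succ_of_ne_zero (show n * 2 ≠ 0 by omega)
        rw [hl]
        exact hidem.pow_succ_eq l
      refine ⟨y, ⟨_, hn.trans (Nat.le_mul_of_pos_right _ (by omega)), hy⟩, ?_, ?_⟩ <;>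
        apply WithOne.coe_injective
      · rw [WithOne.coe_mul, hx, hy, he, ← pow_add, hpow]
      · rw [WithOne.coe_mul, hx, hy, he, ← pow_add, add_comm, hpow]
  obtain ⟨G, _, ⟨f⟩⟩ := hH.exists_mulEquiv
  have hd : Nat.card H ≠ 0 := by
    have : Nonempty H := ⟨⟨e, heH⟩⟩
    exact Nat.card_pos.ne'
  obtain ⟨x, hx⟩ := WithOne.exists_coe_eq_pow s (Nat.succ_ne_zero a)
  have hxH : x ∈ H := ⟨a + 1, by omega, hx⟩
  have hone : f ⟨e, heH⟩ = 1 := by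
    have : (⟨e, heH⟩ : H) * ⟨e, heH⟩ = ⟨e, heH⟩ := by
      apply Subtype.ext
      apply WithOne.coe_injective
      change ((e * e : S) : WithOne S) = e
      rw [WithOne.coe_mul, he, hidem.eq]
    have := congrArg f this
    rwa [map_mul, mul_eq_left] at this
  have hxd : (z ^ (a + 1)) ^ Nat.card H = z ^ a := by
    obtain ⟨y, hy, hy'⟩ := exists_map_eq_pow WithOne.coeMulHom f ⟨x, hxH⟩ hd
    rw [Nat.card_congr f.toEquiv, pow_card_eq_one', ← hone] at hy'
    have hye : y = ⟨e, heH⟩ := f.injective hy'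
    rw [hye] at hy
    change (e : WithOne S) = (x : WithOne S) ^ Nat.card H at hy
    rw [← he, hy, hx]
  have hed : ∀ q, z ^ a * z ^ (Nat.card H * q) = z ^ a := by
    have : z ^ a * z ^ Nat.card H = z ^ a := by
      obtain ⟨l, hl⟩ := Nat.exists_eq_succ_of_ne_zero hd
      have hea : (z ^ a) ^ Nat.card H = z ^ a := by rw [hl]; exact hidem.pow_succ_eq l
      rwa [← pow_mul, add_mul, one_mul, pow_add, pow_mul, hea] at hxd
    intro q
    induction q with
    | zero => simp
    | succ q ih => rw [Nat.mul_succ, pow_add, ← mul_assoc, ih, this]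
  refine ⟨Nat.card H, a, e, hd, fun p hp hpd => h H hH p hp hpd, ?_⟩
  rintro n hn ⟨q, rfl⟩
  rw [he, ← hza _ hn, pow_add, hed]

end Periods

/-! ### The exponent attached to `π` -/

section Exponents

/-- A product of primes of `π` that is divisible by all numbers up to `k` whose prime divisors
belong to `π`. -/
def piExponent (π : Set ℕ) [DecidablePred (· ∈ π)] (k : ℕ) : ℕ :=
  ∏ p ∈ (Finset.range (k + 1)).filter (· ∈ π), p ^ k

variable {π : Set ℕ} [DecidablePred (· ∈ π)]

theorem coprime_piExponent (hπ : ∀ p ∈ π, p.Prime) {p k : ℕ} (hp : p.Prime) (hpπ : p ∉ π) :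
    p.Coprime (piExponent π k) := by
  refine Nat.Coprime.prod_right fun q hq => Nat.Coprime.pow_right _ ?_
  have hq := (Finset.mem_filter.1 hq).2
  exact (Nat.coprime_primes hp (hπ q hq)).2 fun h => hpπ (h ▸ hq)

theorem piExponent_pos (hπ : ∀ p ∈ π, p.Prime) (k : ℕ) : 0 < piExponent π k :=
  Finset.prod_pos fun q hq => pow_pos (hπ q (Finset.mem_filter.1 hq).2).pos _

theorem dvd_piExponent {g k : ℕ} (hg : g ≠ 0) (hgk : g ≤ k)
    (h : ∀ p : ℕ, p.Prime → p ∣ g → p ∈ π) : g ∣ piExponent π k := by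
  have hdvd : g ∣ ∏ p ∈ g.primeFactors, p ^ k := by
    conv_lhs => rw [← Nat.prod_factorization_pow_eq_self hg]
    exact Finset.prod_dvd_prod_of_dvd _ _ fun p _ =>
      pow_dvd_pow p ((Nat.factorization_lt p hg).le.trans hgk)
  refine hdvd.trans (Finset.prod_dvd_prod_of_subset _ _ _ fun p hp => ?_)
  have hp' := Nat.dvd_of_mem_primeFactors hp
  rw [Finset.mem_filter, Finset.mem_range]
  exact ⟨Nat.lt_succ_of_le ((Nat.le_of_dvd (Nat.pos_of_ne_zero hg) hp').trans hgk),
    h p (Nat.prime_of_mem_primeFactors hp) hp'⟩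

/-- The congruences `n ≡ j` modulo the period `m` and `n ≡ 0` modulo `d` are compatible: `m.gcd d`
is at most `k` and has its primes in `π`, so it divides `piExponent π k` and hence `j`. -/
theorem exists_pow_eq_of_period {P : Type*} [Monoid P] {z : P} {i m k j d a : ℕ} (hm : m ≠ 0)
    (hmk : m ≤ k) (h : z ^ (i + m) = z ^ i) (hj : i ≤ j) (hDj : piExponent π k ∣ j) (hd : d ≠ 0)
    (hdπ : ∀ p : ℕ, p.Prime → p ∣ d → p ∈ π) : ∃ n, a ≤ n ∧ d ∣ n ∧ z ^ n = z ^ j := by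
  have hg : m.gcd d ∣ j := (dvd_piExponent (Nat.gcd_ne_zero_left hm)
    ((Nat.gcd_le_left _ (Nat.pos_of_ne_zero hm)).trans hmk)
    fun p hp hpd => hdπ p hp (hpd.trans (Nat.gcd_dvd_right _ _))).trans hDj
  obtain ⟨n, hn₁, hn₂⟩ := Nat.chineseRemainder' (n := m) (m := d) (a := j) (b := 0)
    ((Nat.modEq_zero_iff_dvd).2 hg)
  -- Adding a multiple of `m * d` keeps both congruences and makes the exponent exceed `j` and `a`.
  have hle : j + a ≤ n + m * d * (j + a) :=
    (Nat.le_mul_of_pos_left _ (Nat.pos_of_ne_zero (mul_ne_zero hm hd))).trans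
      (Nat.le_add_left _ _)
  refine ⟨n + m * d * (j + a), by omega, ?_, ?_⟩
  · rw [mul_comm m, mul_assoc]
    exact dvd_add ((Nat.modEq_zero_iff_dvd).1 hn₂) (dvd_mul_right _ _)
  · have hmod : j ≡ n + m * d * (j + a) [MOD m] := by
      refine hn₁.symm.trans ?_
      simp [Nat.ModEq, mul_assoc]
    obtain ⟨q, hq⟩ := (Nat.modEq_iff_dvd' (by omega)).1 hmod
    rw [show n + m * d * (j + a) = j + m * q by omega, pow_add_mul_of_period h hj]

end Exponents

/-! ### The closure family and its soundness -/

section Family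

/-- The exponents `D * k, …, D * (2 * k - 1)`. -/
def expWindow (D k : ℕ) : Set ℕ := (fun i => D * (k + i)) '' Set.Iio k

/-- One round of adding products and the unions of the powers with exponents in `J`. -/
def closeStep {N : Type*} [Monoid N] (J : Set ℕ) (𝒵 : Set (Set N)) : Set (Set N) :=
  𝒵 ∪ Set.image2 (· * ·) 𝒵 𝒵 ∪ (fun Z => ⋃ j ∈ J, Z ^ j) '' 𝒵

/-- The singletons of `T` after `k` rounds of adding products and unions of powers. -/
def pointlikeFamily (T : Type*) [Semigroup T] (D k : ℕ) : Set (Set (WithOne T)) :=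
  (closeStep (expWindow D k))^[k] (Set.range fun t : T => {(t : WithOne T)})

/-- Until the iteration stabilises, each round adds at least one element; `k + 1` strict steps would
give more elements than `α` has. -/
theorem iterate_fixed_of_card_le {α : Type*} [Finite α] {Φ : Set α → Set α} (h : ∀ s, s ⊆ Φ s)
    (s : Set α) {k : ℕ} (hk : Nat.card α ≤ k) : Φ (Φ^[k] s) = Φ^[k] s := by
  by_contra hne
  have hj : ∀ j ≤ k, Φ (Φ^[j] s) ≠ Φ^[j] s := by
    intro j hjk hj
    obtain ⟨l, rfl⟩ := Nat.exists_eq_add_of_le' hjk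
    rw [Function.iterate_add_apply, Function.iterate_fixed hj, hj] at hne
    exact hne rfl
  have hcard : ∀ j ≤ k + 1, j ≤ (Φ^[j] s).ncard := by
    intro j
    induction j with
    | zero => simp
    | succ j ih =>
      intro hjk
      refine (ih (by omega)).trans_lt ?_
      rw [Function.iterate_succ_apply']
      exact Set.ncard_lt_ncard ((h _).ssubset_of_ne (hj j (by omega)).symm) (Set.toFinite _)
  have := (hcard (k + 1) le_rfl).trans (Set.ncard_le_card _)
  omega

variable {T : Type u} [Semigroup T]

theorem closeStep_pointlikeFamily [Finite T] {D k : ℕ}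
    (hk : Nat.card (Set (WithOne T)) ≤ k) :
    closeStep (expWindow D k) (pointlikeFamily T D k) = pointlikeFamily T D k :=
  iterate_fixed_of_card_le (fun _ => Set.subset_union_left.trans Set.subset_union_left) _ hk

theorem singleton_mem_pointlikeFamily (D k : ℕ) (t : T) :
    {(t : WithOne T)} ∈ pointlikeFamily T D k := by
  have h : ∀ (n : ℕ) (𝒵 : Set (Set (WithOne T))), 𝒵 ⊆ (closeStep (expWindow D k))^[n] 𝒵 := by
    intro n
    induction n with
    | zero => exact fun _ => subset_rfl
    | succ n ih =>
      intro 𝒵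
      rw [Function.iterate_succ_apply]
      exact (Set.subset_union_left.trans Set.subset_union_left).trans (ih _)
  exact h _ _ ⟨t, rfl⟩

/-- The pairs of a relational morphism, with a pair of adjoined identities. -/
inductive RelatedWithOne {S : Type u} (φ : T → Set S) : WithOne T → WithOne S → Prop
  | one : RelatedWithOne φ 1 1
  | coe (t : T) (s : S) (h : s ∈ φ t) : RelatedWithOne φ t s

theorem RelatedWithOne.mul {S : Type u} [Semigroup S] {φ : T → Set S}
    (hφ : IsRelationalMorphism φ) {x x' : WithOne T} {y y' : WithOne S}
    (h : RelatedWithOne φ x y) (h' : RelatedWithOne φ x' y') :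
    RelatedWithOne φ (x * x') (y * y') := by
  cases h with
  | one => simpa using h'
  | coe t s h =>
    cases h' with
    | one => simpa using RelatedWithOne.coe t s h
    | coe t' s' h' =>
      rw [← WithOne.coe_mul, ← WithOne.coe_mul]
      exact .coe _ _ (hφ.mul_mem _ _ _ _ h h')

theorem RelatedWithOne.pow {S : Type u} [Semigroup S] {φ : T → Set S}
    (hφ : IsRelationalMorphism φ) {Z : Set (WithOne T)} {y : WithOne S}
    (h : ∀ x ∈ Z, RelatedWithOne φ x y) (n : ℕ) : ∀ x ∈ Z ^ n, RelatedWithOne φ x (y ^ n) := by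
  induction n with
  | zero => rintro _ rfl; exact .one
  | succ n ih =>
    rw [pow_succ, pow_succ]
    rintro _ ⟨x, hx, x', hx', rfl⟩
    exact (ih x hx).mul hφ (h x' hx')

variable {π : Set ℕ} [DecidablePred (· ∈ π)]

theorem exists_related_of_mem_pointlikeFamily [Finite T] (hπ : ∀ p ∈ π, p.Prime) {k : ℕ}
    (hk : Nat.card (Set (WithOne T)) < k) {S : Type u} [Semigroup S] [Finite S]
    (hS : SubgroupsArePiGroups π S) {φ : T → Set S} (hφ : IsRelationalMorphism φ)
    {Y : Set (WithOne T)} (hY : Y ∈ pointlikeFamily T (piExponent π k) k) :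
    ∃ s : S, ∀ x ∈ Y, RelatedWithOne φ x s := by
  have hstep : ∀ n, ∀ Y ∈ (closeStep (expWindow (piExponent π k) k))^[n]
      (Set.range fun t : T => {(t : WithOne T)}), ∃ s : S, ∀ x ∈ Y, RelatedWithOne φ x s := by
    intro n
    induction n with
    | zero =>
      rintro _ ⟨t, rfl⟩
      obtain ⟨s, hs⟩ := hφ.nonempty t
      refine ⟨s, ?_⟩
      rintro _ rfl
      exact .coe t s hs
    | succ n ih =>
      rw [Function.iterate_succ_apply']
      rintro _ ((hY | ⟨Y, hY, Z, hZ, rfl⟩) | ⟨Z, hZ, rfl⟩)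
      · exact ih _ hY
      · obtain ⟨s, hs⟩ := ih _ hY
        obtain ⟨s', hs'⟩ := ih _ hZ
        refine ⟨s * s', ?_⟩
        rintro _ ⟨x, hx, x', hx', rfl⟩
        rw [WithOne.coe_mul]
        exact (hs x hx).mul hφ (hs' x' hx')
      · obtain ⟨s, hs⟩ := ih _ hZ
        obtain ⟨d, a, e, hd, hdπ, he⟩ := hS.exists_period s
        obtain ⟨i, m, hik, hm, hmk, hper⟩ := exists_period hk Z
        refine ⟨e, fun x hx => ?_⟩
        simp only [Set.mem_iUnion] at hx
        obtain ⟨_, ⟨l, -, rfl⟩, hx⟩ := hx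
        -- The exponent `n'` depends on `l`, but `s ^ n'` is always the same `e`; hence `e` serves
        -- the whole union.
        obtain ⟨n', han, hdn, hpow⟩ := exists_pow_eq_of_period (π := π) (a := a)
          (j := piExponent π k * (k + l)) hm hmk hper
          ((hik.trans (Nat.le_add_right k l)).trans
            (Nat.le_mul_of_pos_left _ (piExponent_pos hπ k))) (dvd_mul_right _ _) hd hdπ
        rw [← he n' han hdn]
        exact RelatedWithOne.pow hφ hs n' x (hpow ▸ hx)
  exact hstep k Y hY

end Family

/-! ### Transition semigroups of automata -/

section Transition

variable {T X : Type u} [Semigroup T]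

/-- The transition semigroup of an automaton, written so that words act from the right. -/
def transitionSemigroup {A : Type*} (step : X → A → X) :
    Subsemigroup (Function.End X)ᵐᵒᵖ where
  carrier := {f | ∃ w : List A, w ≠ [] ∧ ∀ x, f.unop x = w.foldl step x}
  mul_mem' := by
    rintro f g ⟨w, hw, hf⟩ ⟨v, -, hg⟩
    refine ⟨w ++ v, by simp [hw], fun x => ?_⟩
    rw [List.foldl_append, ← hf, ← hg]
    rfl

instance [Finite X] : Finite (Function.End X)ᵐᵒᵖ :=
  Finite.of_equiv (X → X) MulOpposite.opEquiv

instance [Finite X] {A : Type*} (step : X → A → X) : Finite (transitionSemigroup step) :=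
  Finite.of_injective _ Subtype.val_injective

/-- By Cauchy's theorem a bad prime `p` yields a subgroup element `x` of order `p`, and `y = x ^ p`
is the identity of the subgroup. States in the image of `y` are fixed by `x ^ p`, hence by `x`. As
`x` acts as `y` followed by `x`, this forces `x = y`, of order `1`. -/
theorem CycleFree.subgroupsArePiGroups {π : Set ℕ} [Finite X] {A : Type*} {step : X → A → X}
    (h : CycleFree π step) : SubgroupsArePiGroups π (transitionSemigroup step) := by
  intro H hH p hp hpd
  by_contra hpπ
  obtain ⟨G, _, ⟨f⟩⟩ := hH.exists_mulEquiv
  have : Finite H := Finite.of_injective _ Subtype.val_injective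
  have : Finite G := Finite.of_equiv _ f.toEquiv
  have : Fact p.Prime := ⟨hp⟩
  rw [Nat.card_congr f.toEquiv] at hpd
  obtain ⟨g, hg⟩ := exists_prime_orderOf_dvd_card' p hpd
  obtain ⟨x, rfl⟩ := f.surjective g
  obtain ⟨e, he⟩ := f.surjective 1
  let ι : transitionSemigroup step →ₙ* (Function.End X)ᵐᵒᵖ :=
    { toFun := Subtype.val, map_mul' := fun _ _ => rfl }
  obtain ⟨y, hy, hy'⟩ := exists_map_eq_pow ι f x hp.ne_zero
  rw [← hg, pow_orderOf_eq_one, ← he] at hy'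
  obtain rfl := f.injective hy'
  obtain ⟨w, -, hw⟩ := x.1.2
  have hex : y * x = x := f.injective (by rw [map_mul, he, one_mul])
  have hee : y * y = y := f.injective (by rw [map_mul, he, one_mul])
  have hxy : x = y := by
    apply Subtype.ext
    apply Subtype.ext
    apply MulOpposite.unop_injective
    funext q
    have hiter : ∀ n q, (MulOpposite.unop (x.1.1 ^ n)) q = (fun q => w.foldl step q)^[n] q := by
      intro n
      induction n with
      | zero => intro q; rfl
      | succ n ih =>
        intro q
        rw [pow_succ', Function.iterate_succ_apply, ← ih, ← hw]
        rfl
    have h₁ : x.1.1.unop (y.1.1.unop q) = x.1.1.unop q := by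
      conv_rhs => rw [← hex]
      rfl
    have h₂ : y.1.1.unop (y.1.1.unop q) = y.1.1.unop q := by
      conv_rhs => rw [← hee]
      rfl
    rw [← h₁, hw]
    refine h w _ p hp hpπ ?_
    rw [← hiter]
    change y.1.1 = x.1.1 ^ p at hy
    rw [← hy, h₂]
  rw [hxy, he, orderOf_one] at hg
  exact hp.ne_one hg.symm

/-- The values of nonempty words that induce a given transition. -/
theorem isRelationalMorphism_transition (step : X → T → X) :
    IsRelationalMorphism fun t : T => {s : transitionSemigroup step |
      ∃ w : List T, (∀ x, s.1.unop x = w.foldl step x) ∧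
        (w.map ((↑) : T → WithOne T)).prod = t} where
  nonempty t := ⟨⟨.op fun x => step x t, [t], by simp, fun _ => rfl⟩, [t], fun _ => rfl, by simp⟩
  mul_mem := by
    rintro t t' s s' ⟨w, hw, hwt⟩ ⟨v, hv, hvt⟩
    refine ⟨w ++ v, fun x => ?_, by simp [hwt, hvt]⟩
    rw [List.foldl_append, ← hw, ← hv]
    rfl

end Transition

/-! ### Pointlike sets as subsets of members of the family -/

section Characterization

variable {T : Type u} [Semigroup T] {π : Set ℕ} [DecidablePred (· ∈ π)]

/-- The family of `pointlikeFamily` with the set `{1}` added. -/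
def pointlikeMonoid [Finite T] {D k : ℕ} (hk : Nat.card (Set (WithOne T)) ≤ k) :
    Submonoid (Set (WithOne T)) where
  carrier := insert 1 (pointlikeFamily T D k)
  one_mem' := Set.mem_insert _ _
  mul_mem' := by
    rintro Y Z (rfl | hY) (rfl | hZ)
    · simp
    · simp [hZ]
    · simp [hY]
    · refine Or.inr ?_
      rw [← closeStep_pointlikeFamily hk]
      exact Or.inl (Or.inr ⟨Y, hY, Z, hZ, rfl⟩)

/-- Unions are joins for inclusion, and multiplication of sets distributes over them. For `{1}` the
union is again `{1}` because `k ≠ 0` makes the set of exponents nonempty. -/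
theorem saturated_pointlikeMonoid [Finite T] {D k : ℕ} (hk : Nat.card (Set (WithOne T)) ≤ k)
    (hk₀ : k ≠ 0) :
    Saturated (expWindow D k) (pointlikeMonoid (T := T) (D := D) hk) := by
  rintro ⟨Z, hZ⟩
  have hU : (⋃ j ∈ expWindow D k, Z ^ j) ∈ pointlikeMonoid (T := T) (D := D) hk := by
    rcases hZ with rfl | hZ
    · have : (expWindow D k).Nonempty := ⟨_, 0, Nat.pos_of_ne_zero hk₀, rfl⟩
      left
      simp only [one_pow]
      exact Set.biUnion_const this _
    · right
      rw [← closeStep_pointlikeFamily hk]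
      exact Or.inr ⟨Z, hZ, rfl⟩
  refine ⟨⟨_, hU⟩, ?_⟩
  rintro ⟨x, hx⟩ ⟨y, hy⟩ ⟨z, hz⟩
  rw [Set.forall_mem_image]
  change x * (⋃ j ∈ expWindow D k, Z ^ j) * y ⊆ z ↔
    ∀ j ∈ expWindow D k, x * Z ^ j * y ⊆ z
  simp only [Set.mul_iUnion, Set.iUnion_mul, Set.iUnion_subset_iff]

instance [Finite T] {D k : ℕ} (hk : Nat.card (Set (WithOne T)) ≤ k) :
    MulLeftMono (pointlikeMonoid (T := T) (D := D) hk) where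
  elim x _ _ h := Set.mul_subset_mul_left (s := x.1) h

theorem isPointlike_iff [Finite T] (hπ : ∀ p ∈ π, p.Prime) {k : ℕ}
    (hk : Nat.card (Set (WithOne T)) < k) (Z : Set T) :
    IsPointlike (fun S _ => SubgroupsArePiGroups π S) Z ↔
      ∃ Y ∈ pointlikeFamily T (piExponent π k) k, ∀ t ∈ Z, (t : WithOne T) ∈ Y := by
  constructor
  · intro h
    obtain ⟨X, _, x₀, step, F, hF₀, hF, hX⟩ := hasCover_of_saturated (π := π)
      (fun p hp hpπ => coprime_piExponent hπ hp hpπ) (pointlikeMonoid (T := T) hk.le)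
      ((Nat.card_le_card_of_injective _ Subtype.val_injective).trans hk.le)
      (saturated_pointlikeMonoid hk.le (by omega)) T
      (fun t => ⟨{(t : WithOne T)}, Or.inr (singleton_mem_pointlikeFamily _ _ t)⟩)
    obtain ⟨s, hs⟩ := h (transitionSemigroup step) hX.subgroupsArePiGroups _
      (isRelationalMorphism_transition step)
    have hmem : ∀ (w : List T) (x : X) (q : WithOne T), q ∈ (F x).1 →
        q * (w.map ((↑) : T → WithOne T)).prod ∈ (F (w.foldl step x)).1 := by
      intro w
      induction w with
      | nil => simp
      | cons t w ih =>
        intro x q hq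
        rw [List.map_cons, List.prod_cons, ← mul_assoc]
        exact ih _ _ (hF x t ⟨q, hq, _, rfl, rfl⟩)
    have hx₀ : ∀ w : List T, (w.map ((↑) : T → WithOne T)).prod ∈ (F (w.foldl step x₀)).1 :=
      fun w => by simpa using hmem w x₀ 1 (hF₀ rfl)
    have hcoe : ∀ w : List T, w ≠ [] →
        ∃ t : T, (w.map ((↑) : T → WithOne T)).prod = t := by
      intro w
      induction w with
      | nil => simp
      | cons t w ih =>
        intro _
        rcases eq_or_ne w [] with rfl | hw
        · exact ⟨t, by simp⟩
        · obtain ⟨t', ht'⟩ := ih hw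
          exact ⟨t * t', by simp [ht']⟩
    obtain ⟨w, hw, hsw⟩ := s.2
    refine ⟨(F (s.1.unop x₀)).1, ?_, fun t ht => ?_⟩
    -- The label is not `{1}`: a nonempty word induces `s`, and its value is an element of `T` lying
    -- in the label.
    · rcases (F (s.1.unop x₀)).2 with h1 | h1
      · obtain ⟨t, ht⟩ := hcoe w hw
        have := hx₀ w
        rw [ht, ← hsw, h1] at this
        exact absurd (Set.mem_one.1 this) WithOne.coe_ne_one
      · exact h1
    · obtain ⟨v, hv, hvt⟩ := hs ht
      rw [hv, ← hvt]
      exact hx₀ v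
  · rintro ⟨Y, hY, hZY⟩ S _ _ hS φ hφ
    obtain ⟨s, hs⟩ := exists_related_of_mem_pointlikeFamily hπ hk hS hφ hY
    refine ⟨s, fun t ht => ?_⟩
    have := hs _ (hZY t ht)
    generalize hx : (t : WithOne T) = x at this
    generalize hy : (s : WithOne S) = y at this
    cases this with
    | one => exact absurd hx WithOne.coe_ne_one
    | coe t' s' h =>
      rw [WithOne.coe_inj] at hx hy
      subst hx hy
      exact h

end Characterization

/-! ### Computability of the list version -/

section Lists

/-- The entry of a multiplication table. -/
def tableMul (tb : List (List ℕ)) (i j : ℕ) : ℕ := (tb.getD i []).getD j 0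

/-- The product of two sets of indices. -/
def listMul (tb : List (List ℕ)) (a b : List ℕ) : List ℕ :=
  a.flatMap fun i => b.map fun j => tableMul tb i j

/-- The `(n + 1)`-st power of a set of indices. -/
def listPow (tb : List (List ℕ)) (a : List ℕ) (n : ℕ) : List ℕ :=
  n.rec a fun _ r => listMul tb r a

/-- The union of the powers with exponents in `expWindow D k`. -/
def listUnionPow (tb : List (List ℕ)) (D k : ℕ) (a : List ℕ) : List ℕ :=
  (List.range k).flatMap fun i => listPow tb a (D * (k + i) - 1)

/-- The list version of `closeStep`. -/
def listStep (tb : List (List ℕ)) (D k : ℕ) (L : List (List ℕ)) : List (List ℕ) :=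
  L ++ (L.flatMap fun a => L.map fun b => listMul tb a b) ++ L.map fun a => listUnionPow tb D k a

/-- The list version of `pointlikeFamily`. -/
def listFamily (tb : List (List ℕ)) (D k : ℕ) : List (List ℕ) :=
  (listStep tb D k)^[k] ((List.range tb.length).map fun i => [i])

/-- All increasing lists of numbers less than `n`. -/
def increasingLists (n : ℕ) : List (List ℕ) :=
  n.rec [[]] fun i r => r ++ r.map fun l => l ++ [i]

/-- A strict upper bound for the number of sets of elements of `WithOne T` if `T` has `n`
elements. -/
def roundBound (n : ℕ) : ℕ := 2 ^ (n + 1) + 1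

open Classical in
/-- The increasing lists of indices that are contained in a member of `listFamily tb D k`. -/
noncomputable def listBelowFamily (tb : List (List ℕ)) (D k : ℕ) : List (List ℕ) :=
  (increasingLists tb.length).filter fun l => ∃ a ∈ listFamily tb D k, ∀ i ∈ l, i ∈ a

section Primrec

variable {α : Type*} [Primcodable α] {tb : α → List (List ℕ)}

theorem primrec_tableMul {i j : α → ℕ} (htb : Primrec tb) (hi : Primrec i) (hj : Primrec j) :
    Primrec fun x => tableMul (tb x) (i x) (j x) :=
  (Primrec.list_getD 0).comp ((Primrec.list_getD []).comp htb hi) hj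

theorem primrec_listMul {a b : α → List ℕ} (htb : Primrec tb) (ha : Primrec a) (hb : Primrec b) :
    Primrec fun x => listMul (tb x) (a x) (b x) :=
  Primrec.list_flatMap ha <| Primrec.to₂ <| Primrec.list_map (hb.comp .fst) <| Primrec.to₂ <|
    primrec_tableMul (htb.comp (Primrec.fst.comp .fst)) (Primrec.snd.comp .fst) .snd

theorem primrec_listPow {a : α → List ℕ} {n : α → ℕ} (htb : Primrec tb) (ha : Primrec a)
    (hn : Primrec n) : Primrec fun x => listPow (tb x) (a x) (n x) := by
  have h : Primrec₂ fun (x : α) (q : ℕ × List ℕ) => listMul (tb x) q.2 (a x) :=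
    primrec_listMul (htb.comp .fst) (Primrec.snd.comp .snd) (ha.comp .fst)
  exact Primrec.nat_rec' hn ha h

theorem primrec_listUnionPow {D k : α → ℕ} {a : α → List ℕ} (htb : Primrec tb) (hD : Primrec D)
    (hk : Primrec k) (ha : Primrec a) :
    Primrec fun x => listUnionPow (tb x) (D x) (k x) (a x) :=
  Primrec.list_flatMap (Primrec.list_range.comp hk) <| Primrec.to₂ <|
    primrec_listPow (htb.comp .fst) (ha.comp .fst) <| Primrec.nat_sub.comp
      (Primrec.nat_mul.comp (hD.comp .fst) (Primrec.nat_add.comp (hk.comp .fst) .snd)) (.const 1)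

theorem primrec_listStep {D k : α → ℕ} {L : α → List (List ℕ)} (htb : Primrec tb) (hD : Primrec D)
    (hk : Primrec k) (hL : Primrec L) :
    Primrec fun x => listStep (tb x) (D x) (k x) (L x) := by
  have h₁ : Primrec fun x => (L x).flatMap fun a => (L x).map fun b => listMul (tb x) a b :=
    Primrec.list_flatMap hL <| Primrec.to₂ <| Primrec.list_map (hL.comp .fst) <| Primrec.to₂ <|
      primrec_listMul (htb.comp (Primrec.fst.comp .fst)) (Primrec.snd.comp .fst) .snd
  have h₂ : Primrec fun x => (L x).map fun a => listUnionPow (tb x) (D x) (k x) a :=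
    Primrec.list_map hL <| Primrec.to₂ <|
      primrec_listUnionPow (htb.comp .fst) (hD.comp .fst) (hk.comp .fst) .snd
  exact Primrec.list_append.comp (Primrec.list_append.comp hL h₁) h₂

theorem primrec_listFamily {D k : α → ℕ} (htb : Primrec tb) (hD : Primrec D) (hk : Primrec k) :
    Primrec fun x => listFamily (tb x) (D x) (k x) := by
  have h₁ : Primrec fun x => (List.range (tb x).length).map fun i => [i] :=
    Primrec.list_map (Primrec.list_range.comp (Primrec.list_length.comp htb)) <| Primrec.to₂ <|
      Primrec.list_cons.comp .snd (.const [])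
  have h₂ : Primrec₂ fun (x : α) (L : List (List ℕ)) => listStep (tb x) (D x) (k x) L :=
    primrec_listStep (htb.comp .fst) (hD.comp .fst) (hk.comp .fst) .snd
  exact Primrec.nat_iterate hk h₁ h₂

end Primrec

theorem primrec_increasingLists : Primrec increasingLists := by
  have h₁ : Primrec₂ fun (q : ℕ × ℕ × List (List ℕ)) (l : List ℕ) => l ++ [q.2.1] :=
    Primrec.list_concat.comp .snd (Primrec.fst.comp (Primrec.snd.comp .fst))
  have h₂ : Primrec₂ fun (_ : ℕ) (q : ℕ × List (List ℕ)) => q.2 ++ q.2.map fun l => l ++ [q.1] :=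
    Primrec.list_append.comp (Primrec.snd.comp .snd) (Primrec.list_map (Primrec.snd.comp .snd) h₁)
  exact Primrec.nat_rec' .id (.const [[]]) h₂

theorem primrec_pow : Primrec₂ fun a b : ℕ => a ^ b := by
  have h : Primrec₂ fun (p : ℕ × ℕ) (q : ℕ × ℕ) => q.2 * p.1 :=
    Primrec.nat_mul.comp (Primrec.snd.comp .snd) (Primrec.fst.comp .fst)
  refine (Primrec.nat_rec' .snd (.const 1) h).of_eq fun p => ?_
  induction p.2 with
  | zero => rfl
  | succ n ih => exact congrArg (· * p.1) ih

theorem primrec_roundBound : Primrec roundBound :=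
  Primrec.succ.comp (primrec_pow.comp (.const 2) .succ)

theorem primrecRel_subset : PrimrecRel fun l a : List ℕ => ∀ i ∈ l, i ∈ a := by
  refine PrimrecRel.forall_mem_list (R := fun i (a : List ℕ) => i ∈ a) ?_
  have : PrimrecRel fun (a : List ℕ) i => ∃ j ∈ a, j = i :=
    PrimrecRel.exists_mem_list Primrec.eq
  exact this.swap.of_eq fun i a => by simp [Function.swap]

theorem primrec_listBelowFamily {α : Type*} [Primcodable α] {tb : α → List (List ℕ)} {D k : α → ℕ}
    (htb : Primrec tb) (hD : Primrec D) (hk : Primrec k) :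
    Primrec fun x => listBelowFamily (tb x) (D x) (k x) := by
  classical
  have h : PrimrecRel fun (l : List ℕ) (L : List (List ℕ)) => ∃ a ∈ L, ∀ i ∈ l, i ∈ a :=
    (PrimrecRel.exists_mem_list primrecRel_subset.swap).swap
  exact (h.listFilter.comp (primrec_increasingLists.comp (Primrec.list_length.comp htb))
    (primrec_listFamily htb hD hk)).of_eq fun p => by rw [listBelowFamily]

theorem computable_piExponent {π : Set ℕ} [DecidablePred (· ∈ π)]
    (h : Computable fun p : ℕ => decide (p ∈ π)) : Computable (piExponent π) := by
  have hstep : Computable₂ fun (k : ℕ) (q : ℕ × ℕ) =>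
      bif decide (q.1 ∈ π) then q.2 * q.1 ^ k else q.2 :=
    Computable.cond (h.comp (Computable.fst.comp .snd))
      (Primrec.to_comp (Primrec.nat_mul.comp (Primrec.snd.comp .snd)
        (primrec_pow.comp (Primrec.fst.comp .snd) .fst)))
      (Computable.snd.comp .snd)
  refine (Computable.nat_rec Computable.succ (Computable.const 1) hstep).of_eq fun k => ?_
  rw [piExponent, ← Nat.succ_eq_add_one]
  generalize k.succ = n
  induction n with
  | zero => rfl
  | succ n ih =>
    rw [Finset.range_add_one, Finset.filter_insert]
    change (bif decide (n ∈ π) then _ * n ^ k else _) = _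
    rw [ih]
    split_ifs with hn
    · rw [Finset.prod_insert (by simp), decide_eq_true hn, cond_true, mul_comm]
    · rw [decide_eq_false hn, cond_false]

/-- The set `π` enters only through the number `piExponent`; everything else is primitive recursive
in the table and that number. -/
theorem computable_listBelowFamily {π : Set ℕ} [DecidablePred (· ∈ π)]
    (h : Computable fun p : ℕ => decide (p ∈ π)) : Computable fun tb : List (List ℕ) =>
      listBelowFamily tb (piExponent π (roundBound tb.length)) (roundBound tb.length) := by
  have hbound : Primrec fun tb : List (List ℕ) => roundBound tb.length :=
    primrec_roundBound.comp .list_length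
  have hbelow : Primrec₂ fun (tb : List (List ℕ)) (D : ℕ) =>
      listBelowFamily tb D (roundBound tb.length) :=
    primrec_listBelowFamily .fst .snd (hbound.comp .fst)
  exact hbelow.to_comp.comp Computable.id ((computable_piExponent h).comp hbound.to_comp)

/-- An increasing list is determined by its members; this normal form allows comparison with
`indexList` by membership alone. -/
theorem mem_increasingLists {n : ℕ} {l : List ℕ} :
    l ∈ increasingLists n ↔ (List.range n).filter (· ∈ l) = l := by
  have h : l ∈ increasingLists n ↔ ∃ P : ℕ → Bool, (List.range n).filter P = l := by
    induction n generalizing l with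
    | zero => simp [increasingLists, eq_comm]
    | succ n ih =>
      have : increasingLists (n + 1) =
        increasingLists n ++ (increasingLists n).map fun l => l ++ [n] := rfl
      simp only [this, List.mem_append, List.mem_map, ih, List.range_succ, List.filter_append]
      constructor
      · rintro (⟨P, rfl⟩ | ⟨_, ⟨P, rfl⟩, rfl⟩)
        · refine ⟨fun i => P i && decide (i ≠ n), ?_⟩
          rw [List.filter_congr (q := P) fun i hi => by
            simp [(List.mem_range.1 hi).ne]]
          simp
        · refine ⟨fun i => P i || decide (i = n), ?_⟩
          rw [List.filter_congr (q := P) fun i hi => by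
            simp [(List.mem_range.1 hi).ne]]
          simp
      · rintro ⟨P, rfl⟩
        by_cases hn : P n
        · exact Or.inr ⟨_, ⟨P, rfl⟩, by simp [hn]⟩
        · exact Or.inl ⟨P, by simp [hn]⟩
  rw [h]
  constructor
  · rintro ⟨P, rfl⟩
    exact List.filter_congr fun i hi => by simp_all
  · exact fun h => ⟨_, h⟩

end Lists

/-! ### Correctness of the list version -/

section Representation

variable {T : Type u} {n : ℕ}

/-- The list `a` consists of the indices of the elements of `Z`. -/
def Represents (e : Fin n ≃ T) (a : List ℕ) (Z : Set (WithOne T)) : Prop :=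
  (∀ i ∈ a, i < n) ∧ ∀ x, x ∈ Z ↔ ∃ i : Fin n, (i : ℕ) ∈ a ∧ x = (e i : WithOne T)

/-- The members of the list `L` are the index lists of the members of `𝒵`. -/
def RepresentsFamily (e : Fin n ≃ T) (L : List (List ℕ)) (𝒵 : Set (Set (WithOne T))) : Prop :=
  (∀ a ∈ L, ∃ Z ∈ 𝒵, Represents e a Z) ∧ ∀ Z ∈ 𝒵, ∃ a ∈ L, Represents e a Z

variable {e : Fin n ≃ T}

theorem mem_indexList {Z : Set T} {i : ℕ} :
    i ∈ indexList e Z ↔ ∃ h : i < n, e ⟨i, h⟩ ∈ Z := by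
  simp only [indexList, List.mem_map, List.mem_filter, List.mem_finRange, true_and,
    decide_eq_true_eq]
  exact ⟨fun ⟨j, hj, hji⟩ => ⟨hji ▸ j.2, by subst hji; exact hj⟩, fun ⟨h, hi⟩ => ⟨_, hi, rfl⟩⟩

theorem indexList_eq_filter (Z : Set T) :
    indexList e Z = (List.range n).filter (· ∈ indexList e Z) := by
  conv_rhs => rw [← List.map_coe_finRange_eq_range, List.filter_map]
  rw [indexList]
  refine congrArg _ (List.filter_congr fun i _ => ?_)
  simp only [Function.comp_apply]
  congr 1
  rw [eq_iff_iff, ← indexList, mem_indexList]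
  simp

theorem indexList_eq_iff {Z : Set T} {l : List ℕ} :
    indexList e Z = l ↔ l ∈ increasingLists n ∧ ∀ i : Fin n, (i : ℕ) ∈ l ↔ e i ∈ Z := by
  constructor
  · rintro rfl
    exact ⟨mem_increasingLists.2 (indexList_eq_filter Z).symm, fun i => by simp [mem_indexList]⟩
  · rintro ⟨hl, h⟩
    rw [indexList_eq_filter]
    refine Eq.trans ?_ (mem_increasingLists.1 hl)
    refine List.filter_congr fun i hi => ?_
    have hi := List.mem_range.1 hi
    congr 1
    rw [eq_iff_iff, mem_indexList, h ⟨i, hi⟩]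
    simp [hi]

variable [Semigroup T]

theorem tableMul_mulTable (i j : Fin n) : tableMul (mulTable e) i j = e.symm (e i * e j) := by
  simp [tableMul, mulTable]

theorem Represents.mul {a b : List ℕ} {Y Z : Set (WithOne T)} (ha : Represents e a Y)
    (hb : Represents e b Z) : Represents e (listMul (mulTable e) a b) (Y * Z) := by
  constructor
  · intro m hm
    simp only [listMul, List.mem_flatMap, List.mem_map] at hm
    obtain ⟨i, hi, j, hj, rfl⟩ := hm
    have := tableMul_mulTable (e := e) ⟨i, ha.1 i hi⟩ ⟨j, hb.1 j hj⟩
    exact this ▸ Fin.is_lt _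
  · intro x
    simp only [listMul, List.mem_flatMap, List.mem_map]
    constructor
    · rintro ⟨y, hy, z, hz, rfl⟩
      obtain ⟨i, hi, rfl⟩ := (ha.2 y).1 hy
      obtain ⟨j, hj, rfl⟩ := (hb.2 z).1 hz
      exact ⟨e.symm (e i * e j), ⟨i, hi, j, hj, tableMul_mulTable i j⟩, by simp⟩
    · rintro ⟨m, ⟨i, hi, j, hj, hm⟩, rfl⟩
      refine ⟨_, (ha.2 _).2 ⟨⟨i, ha.1 i hi⟩, hi, rfl⟩, _, (hb.2 _).2 ⟨⟨j, hb.1 j hj⟩, hj, rfl⟩, ?_⟩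
      have := (tableMul_mulTable (e := e) ⟨i, ha.1 i hi⟩ ⟨j, hb.1 j hj⟩).symm.trans hm
      rw [← Fin.ext this]
      simp

theorem Represents.pow {a : List ℕ} {Z : Set (WithOne T)} (ha : Represents e a Z) (m : ℕ) :
    Represents e (listPow (mulTable e) a m) (Z ^ (m + 1)) := by
  induction m with
  | zero => rw [zero_add, pow_one]; exact ha
  | succ m ih => rw [pow_succ]; exact ih.mul ha

theorem Represents.unionPow {a : List ℕ} {Z : Set (WithOne T)} (ha : Represents e a Z) {D k : ℕ}
    (hD : D ≠ 0) (hk : k ≠ 0) :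
    Represents e (listUnionPow (mulTable e) D k a) (⋃ j ∈ expWindow D k, Z ^ j) := by
  have hpow : ∀ i, Represents e (listPow (mulTable e) a (D * (k + i) - 1)) (Z ^ (D * (k + i))) := by
    intro i
    have := ha.pow (D * (k + i) - 1)
    -- `listPow` counts from the first power, as the adjoined identity has no index; positive
    -- exponents make the subtraction of one exact.
    rwa [Nat.sub_add_cancel (Nat.pos_of_ne_zero (mul_ne_zero hD (by omega)))] at this
  constructor
  · intro m hm
    simp only [listUnionPow, List.mem_flatMap] at hm
    obtain ⟨i, -, hi⟩ := hm
    exact (hpow i).1 m hi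
  · intro x
    simp only [listUnionPow, List.mem_flatMap, expWindow, Set.mem_iUnion, Set.mem_image,
      Set.mem_Iio, List.mem_range]
    constructor
    · rintro ⟨_, ⟨i, hi, rfl⟩, hx⟩
      obtain ⟨m, hm, rfl⟩ := ((hpow i).2 x).1 hx
      exact ⟨m, ⟨i, hi, hm⟩, rfl⟩
    · rintro ⟨m, ⟨i, hi, hm⟩, rfl⟩
      exact ⟨_, ⟨i, hi, rfl⟩, ((hpow i).2 _).2 ⟨m, hm, rfl⟩⟩

theorem RepresentsFamily.step {L : List (List ℕ)} {𝒵 : Set (Set (WithOne T))}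
    (h : RepresentsFamily e L 𝒵) {D k : ℕ} (hD : D ≠ 0) (hk : k ≠ 0) :
    RepresentsFamily e (listStep (mulTable e) D k L) (closeStep (expWindow D k) 𝒵) := by
  constructor
  · intro a ha
    simp only [listStep, List.mem_append, List.mem_flatMap, List.mem_map] at ha
    rcases ha with (ha | ⟨a, ha, b, hb, rfl⟩) | ⟨a, ha, rfl⟩
    · obtain ⟨Z, hZ, haZ⟩ := h.1 a ha
      exact ⟨Z, Or.inl (Or.inl hZ), haZ⟩
    · obtain ⟨Y, hY, haY⟩ := h.1 a ha
      obtain ⟨Z, hZ, hbZ⟩ := h.1 b hb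
      exact ⟨_, Or.inl (Or.inr ⟨Y, hY, Z, hZ, rfl⟩), haY.mul hbZ⟩
    · obtain ⟨Z, hZ, haZ⟩ := h.1 a ha
      exact ⟨_, Or.inr ⟨Z, hZ, rfl⟩, haZ.unionPow hD hk⟩
  · simp only [listStep, List.mem_append, List.mem_flatMap, List.mem_map]
    rintro _ ((hZ | ⟨Y, hY, Z, hZ, rfl⟩) | ⟨Z, hZ, rfl⟩)
    · obtain ⟨a, ha, haZ⟩ := h.2 _ hZ
      exact ⟨a, Or.inl (Or.inl ha), haZ⟩
    · obtain ⟨a, ha, haY⟩ := h.2 _ hY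
      obtain ⟨b, hb, hbZ⟩ := h.2 _ hZ
      exact ⟨_, Or.inl (Or.inr ⟨a, ha, b, hb, rfl⟩), haY.mul hbZ⟩
    · obtain ⟨a, ha, haZ⟩ := h.2 _ hZ
      exact ⟨_, Or.inr ⟨a, ha, rfl⟩, haZ.unionPow hD hk⟩

theorem representsFamily_listFamily {D k : ℕ} (hD : D ≠ 0) (hk : k ≠ 0) :
    RepresentsFamily e (listFamily (mulTable e) D k) (pointlikeFamily T D k) := by
  have hlen : (mulTable e).length = n := by simp [mulTable]
  have hsingle : ∀ i : Fin n, Represents e [(i : ℕ)] {(e i : WithOne T)} := fun i =>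
    ⟨by simp, fun x => by simp [← Fin.ext_iff]⟩
  have hbase : RepresentsFamily e ((List.range (mulTable e).length).map fun i => [i])
      (Set.range fun t : T => {(t : WithOne T)}) := by
    constructor
    · intro a ha
      obtain ⟨i, hi, rfl⟩ := List.mem_map.1 ha
      rw [hlen, List.mem_range] at hi
      exact ⟨_, ⟨e ⟨i, hi⟩, rfl⟩, hsingle ⟨i, hi⟩⟩
    · rintro _ ⟨t, rfl⟩
      refine ⟨[(e.symm t : ℕ)], List.mem_map.2 ⟨_, ?_, rfl⟩, ?_⟩
      · rw [hlen, List.mem_range]; exact Fin.is_lt _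
      · simpa using hsingle (e.symm t)
  have : ∀ m, RepresentsFamily e
      ((listStep (mulTable e) D k)^[m] ((List.range (mulTable e).length).map fun i => [i]))
      ((closeStep (expWindow D k))^[m] (Set.range fun t : T => {(t : WithOne T)})) := by
    intro m
    induction m with
    | zero => exact hbase
    | succ m ih =>
      rw [Function.iterate_succ_apply', Function.iterate_succ_apply']
      exact ih.step hD hk
  exact this k

theorem mem_listBelowFamily_iff {π : Set ℕ} [DecidablePred (· ∈ π)] (hπ : ∀ p ∈ π, p.Prime)
    (l : List ℕ) :
    l ∈ listBelowFamily (mulTable e) (piExponent π (roundBound n)) (roundBound n) ↔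
      ∃ Z : Set T, IsPointlike (fun S _ => SubgroupsArePiGroups π S) Z ∧ indexList e Z = l := by
  classical
  have : Finite T := Finite.of_equiv _ e
  have hlen : (mulTable e).length = n := by simp [mulTable]
  have hcard : Nat.card (Set (WithOne T)) < roundBound n := by
    have : Fintype T := Fintype.ofFinite T
    have hT : Nat.card (WithOne T) = n + 1 := by
      have h : Nat.card (Option T) = Nat.card T + 1 := Finite.card_option
      rw [← Nat.card_congr e, Nat.card_fin] at h
      exact h
    have : Nat.card (Set (WithOne T)) = 2 ^ (n + 1) := by
      have h : Nat.card (WithOne T → Prop) = 2 ^ Nat.card (WithOne T) := by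
        rw [Nat.card_fun]; simp
      rw [← hT]
      exact h
    rw [this, roundBound]
    exact Nat.lt_succ_self _
  have hrep := representsFamily_listFamily (e := e)
    (piExponent_pos hπ (roundBound n)).ne' (Nat.succ_ne_zero (2 ^ (n + 1)))
  simp only [listBelowFamily, List.mem_filter, hlen, decide_eq_true_eq, isPointlike_iff hπ hcard,
    indexList_eq_iff]
  constructor
  · rintro ⟨hl, a, ha, hla⟩
    obtain ⟨Y, hY, haY⟩ := hrep.1 a ha
    -- The pointlike set is read off from `l` itself, and the member of the family containing it
    -- from `a`.
    refine ⟨{t | ((e.symm t : Fin n) : ℕ) ∈ l}, ⟨Y, hY, fun t ht => ?_⟩, hl, fun i => by simp⟩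
    exact (haY.2 _).2 ⟨e.symm t, hla _ ht, by simp⟩
  · rintro ⟨Z, ⟨Y, hY, hZY⟩, hl, hlZ⟩
    obtain ⟨a, ha, haY⟩ := hrep.2 Y hY
    refine ⟨hl, a, ha, fun i hi => ?_⟩
    have hin : i < n := by
      rw [← mem_increasingLists.1 hl] at hi
      exact List.mem_range.1 (List.mem_filter.1 hi).1
    obtain ⟨j, hj, hij⟩ := (haY.2 _).1 (hZY _ ((hlZ ⟨i, hin⟩).1 hi))
    rw [WithOne.coe_inj, e.apply_eq_iff_eq] at hij
    rwa [← hij] at hj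

end Representation

theorem mainTheorem2 (π : Set ℕ) (hπ : ∀ p ∈ π, p.Prime)
    (hrec : ComputablePred fun p : ℕ => p ∈ π) :
    ∃ F : List (List ℕ) → List (List ℕ), Computable F ∧
      ∀ (T : Type*) [Semigroup T] (n : ℕ) (e : Fin n ≃ T) (l : List ℕ),
        l ∈ F (mulTable e) ↔
          ∃ Z : Set T, IsPointlike (fun S _ => SubgroupsArePiGroups π S) Z ∧ indexList e Z = l := by
  obtain ⟨_, hdec⟩ := hrec
  refine ⟨fun tb => listBelowFamily tb (piExponent π (roundBound tb.length))
    (roundBound tb.length), computable_listBelowFamily hdec, ?_⟩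
  intro T _ n e l
  have hlen : (mulTable e).length = n := by simp [mulTable]
  rw [← mem_listBelowFamily_iff hπ]
  simp only [hlen]
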